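/- Proposition 3.3. Let $L:X\to Y$ be a bounded linear operator between real Hilbert spaces, $y\in\mathcal R(L)$, and let $x^\dagger$ be the minimum-norm solution of $Lx=y$. Let $(r_\alpha)_{\alpha>0}$ be a family of continuous functions $r_\alpha:[0,\infty)\to[0,\infty)$ with error functions $\tilde r_\alpha(\lambda)=(1-\lambda r_\alpha(\lambda))^2$, $\lambda\ge0$, such that (i) there is $\rho\in(0,1)$ with $r_\alpha(\lambda)\le\min\{\frac1\lambda,\frac{\rho}{\sqrt{\alpha\lambda}}\}$ for all $\lambda>0$, $\alpha>0$; (ii) $\lambda\mapsto\tilde r_\alpha(\lambda)$ is (not necessarily strictly) decreasing on $[0,\infty)$ for every $\alpha>0$; (iii) $\alpha\mapsto\tilde r_\alpha(\lambda)$ is continuous and (not necessarily strictly) increasing on $(0,\infty)$ for every $\lambda\ge0$; (iv) there is $\tilde\rho\in(0,1)$ with $\tilde r_\alpha(\alpha)<\tilde\rho$ for all $\alpha>0$. Put $x_\alpha(\tilde y)=r_\alpha(L^*L)L^*\tilde y$ for $\tilde y\in Y$ and $\alpha>0$, where $r_\alpha(L^*L)$ is given by the functional calculus of the self-adjoint operator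 $L^*L$. Let $\varphi:[0,\infty)\to[0,\infty)$ be strictly increasing with $\varphi(0)=0$, and let $g:(0,\infty)\to(0,\infty)$ be an increasing function with $$\varphi(\gamma\alpha)\le g(\gamma)\varphi(\alpha)\quad\text{for all }\alpha>0,\ \gamma>0.$$ Assume that there are constants $C>0$ and $\tilde C>0$ with $$\frac{\tilde r_\alpha(\lambda)}{\tilde r_\beta(\lambda)}\le C\,\frac{\varphi(\alpha)}{\varphi(\beta)}\quad\text{for all }0<\alpha\le\beta\le\lambda,\qquad \frac{\tilde r_\alpha(\lambda)}{\tilde r_\beta(\lambda)}\ge\tilde C\,\frac{\varphi(\alpha)}{\varphi(\beta)}\quad\text{for all }0<\lambda\le\alpha\le\beta,$$ where in the first condition $\frac00$ is read as $0$ (if $\tilde r_\beta(\lambda)=0$ then $\tilde r_\alpha(\lambda)=0$ by (iii); in the second condition the denominator is positive by (i) and (ii)). Define $$\tilde\varphi(\alpha)=\sqrt{\alpha\varphi(\alpha)},\qquad \tilde\varphi^{-1}(\delta)=\inf\{\alpha\ge0 : \tilde\varphi(\alpha)\ge\delta\},\qquad \psi(\delta)=\frac{\delta^2}{\tilde\varphi^{-1}(\delta)}\quad(\delta>0),$$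 so that $\tilde\varphi^{-1}$ is the ordinary inverse of $\tilde\varphi$ on its range (in particular for all $\delta$ if $\varphi$ is continuous). Then the following two statements are equivalent: 1. There is a constant $c>0$ such that $$\sup_{\tilde y\in Y,\ \|\tilde y-y\|\le\delta}\ \inf_{\alpha>0}\|x_\alpha(\tilde y)-x^\dagger\|^2\le c\,\psi(\delta)\quad\text{for all }\delta>0.$$ 2. There is a constant $\tilde c>0$ such that $$\|x_\alpha(y)-x^\dagger\|^2\le\tilde c\,\varphi(\alpha)\quad\text{for all }\alpha>0.$$ -/

import Mathlib

/-! Functional calculus of self-adjoint operators on a real Hilbert space. Mathlib provides its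
continuous functional calculus `cfc` only for complex C⋆-algebras; the instance below provides it
for the bounded operators on a real Hilbert space. -/

section RealCFC

open Polynomial

variable {H : Type*} [NormedAddCommGroup H] [InnerProductSpace ℝ H] [CompleteSpace H]

theorem RealCFC.isUnit_sq_add {a : H →L[ℝ] H} (ha : IsSelfAdjoint a) (b c : ℝ) (hc : c ≠ 0) :
    IsUnit ((a - algebraMap ℝ (H →L[ℝ] H) b) ^ 2 + algebraMap ℝ (H →L[ℝ] H) (c ^ 2)) := by
  have hs : IsSelfAdjoint (a - algebraMap ℝ (H →L[ℝ] H) b) :=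
    ha.sub (IsSelfAdjoint.algebraMap _ (IsSelfAdjoint.all b))
  have hp : ((a - algebraMap ℝ (H →L[ℝ] H) b) ^ 2).IsPositive := by
    have h := ContinuousLinearMap.isPositive_adjoint_comp_self (a - algebraMap ℝ (H →L[ℝ] H) b)
    rw [hs.adjoint_eq] at h
    rw [pow_two]
    exact h
  have h1 := SpectrumRestricts.nnreal_iff.mp hp.spectrumRestricts
  have h2 : -(c ^ 2) ∉ spectrum ℝ ((a - algebraMap ℝ (H →L[ℝ] H) b) ^ 2) := fun h => by
    have := h1 _ h
    have := pow_pos (abs_pos.mpr hc) 2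
    rw [sq_abs] at this
    linarith
  rw [spectrum.notMem_iff, ← IsUnit.neg_iff] at h2
  convert h2 using 1
  rw [map_neg]
  abel

theorem RealCFC.isUnit_aeval {a : H →L[ℝ] H} (ha : IsSelfAdjoint a) (n : ℕ) :
    ∀ q : ℝ[X], q ≠ 0 → q.natDegree ≤ n → (∀ x ∈ spectrum ℝ a, q.eval x ≠ 0) →
      IsUnit (aeval a q) := by
  induction n with
  | zero =>
    intro q hq hd _
    rw [eq_C_of_natDegree_le_zero hd] at hq ⊢
    rw [aeval_C]
    exact (IsUnit.mk0 _ (by simpa using hq)).map _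
  | succ n ih =>
    intro q hq hd hroot
    by_cases h0 : q.natDegree ≤ n
    · exact ih q hq h0 hroot
    have hdeg : q.degree ≠ 0 := by
      intro h
      exact h0 ((natDegree_eq_of_degree_eq_some (n := 0) (by simpa using h)).trans_le n.zero_le)
    obtain ⟨z, hz⟩ := IsAlgClosed.exists_aeval_eq_zero ℂ q hdeg
    have key : ∀ u v : ℝ[X], q = u * v → 0 < u.natDegree → IsUnit (aeval a u) →
        IsUnit (aeval a q) := by
      intro u v huv hu hunit
      have hu0 : u ≠ 0 := by rintro rfl; simp at hu
      have hv0 : v ≠ 0 := by rintro rfl; simp [hq] at huv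
      have hv : IsUnit (aeval a v) := by
        refine ih v hv0 ?_ fun x hx h => hroot x hx (by rw [huv, eval_mul, h, mul_zero])
        have := natDegree_mul hu0 hv0
        rw [← huv] at this
        omega
      rw [huv, map_mul]
      exact hunit.mul hv
    by_cases him : z.im = 0
    · have hzr : z = (z.re : ℂ) := Complex.ext rfl (by simpa using him)
      have hr : q.eval z.re = 0 := by
        rw [hzr, ← Complex.coe_algebraMap, aeval_algebraMap_apply, Complex.coe_algebraMap,
          Complex.ofReal_eq_zero] at hz
        simpa using hz
      obtain ⟨v, hv⟩ := dvd_iff_isRoot.mpr hr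
      refine key _ v hv (by simp) ?_
      have : z.re ∉ spectrum ℝ a := fun h => hroot _ h hr
      rw [spectrum.notMem_iff, ← IsUnit.neg_iff, neg_sub] at this
      simpa using this
    · obtain ⟨v, hv⟩ := q.quadratic_dvd_of_aeval_eq_zero_im_ne_zero hz him
      refine key _ v hv ?_ ?_
      · have : (X ^ 2 - C (2 * z.re) * X + C (‖z‖ ^ 2) : ℝ[X]).natDegree = 2 := by compute_degree!
        omega
      · convert RealCFC.isUnit_sq_add ha z.re z.im him using 1
        have hn : ‖z‖ ^ 2 = z.re ^ 2 + z.im ^ 2 := by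
          rw [Complex.sq_norm, Complex.normSq_apply]; ring
        have hcomm := Algebra.commutes z.re a
        rw [hn]
        simp only [map_add, map_sub, map_mul, aeval_X, aeval_C, pow_two,
          sub_mul, mul_sub, hcomm, two_mul, add_mul]
        abel

theorem RealCFC.spectrum_aeval {a : H →L[ℝ] H} (ha : IsSelfAdjoint a) (p : ℝ[X])
    {l : ℝ} (hl : l ∈ spectrum ℝ (aeval a p)) (hne : (spectrum ℝ a).Nonempty) :
    ∃ x ∈ spectrum ℝ a, p.eval x = l := by
  by_contra! h
  have hq : p - C l ≠ 0 := by
    intro h0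
    obtain ⟨x, hx⟩ := hne
    apply h x hx
    have := congrArg (eval x) h0
    simpa [sub_eq_zero] using this
  have := RealCFC.isUnit_aeval ha _ (p - C l) hq le_rfl fun x hx h0 => h x hx (by
    simpa [sub_eq_zero] using h0)
  rw [spectrum.mem_iff, ← IsUnit.neg_iff, neg_sub] at hl
  exact hl (by simpa using this)

theorem RealCFC.isSelfAdjoint_aeval {a : H →L[ℝ] H} (ha : IsSelfAdjoint a) (p : ℝ[X]) :
    IsSelfAdjoint (aeval a p) := by
  induction p using Polynomial.induction_on' with
  | add p q hp hq => rw [map_add]; exact hp.add hq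
  | monomial n c =>
    rw [aeval_monomial, ← Algebra.smul_def]
    exact (IsSelfAdjoint.all c).smul (ha.pow n)

theorem RealCFC.spectrum_nonempty [Nontrivial (H →L[ℝ] H)] {a : H →L[ℝ] H}
    (ha : IsSelfAdjoint a) : (spectrum ℝ a).Nonempty := by
  by_contra! h
  have h1 := ContinuousLinearMap.spectralRadius_eq_nnnorm a ha
  have h2 : a = 0 := by
    simpa [spectralRadius, h] using h1.symm
  rw [h2, spectrum.zero_eq] at h
  exact Set.singleton_ne_empty _ h

theorem RealCFC.norm_aeval {a : H →L[ℝ] H} (ha : IsSelfAdjoint a) (p : ℝ[X]) :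
    ‖aeval a p‖ = ‖p.toContinuousMapOn (spectrum ℝ a)‖ := by
  cases subsingleton_or_nontrivial (H →L[ℝ] H) with
  | inl hs =>
    have : IsEmpty (spectrum ℝ a) := by
      rw [spectrum.of_subsingleton]; infer_instance
    rw [Subsingleton.elim (aeval a p) 0, norm_zero]
    symm
    rw [norm_eq_zero]
    ext x
    exact (IsEmpty.false x).elim
  | inr hn =>
    have hp := RealCFC.isSelfAdjoint_aeval ha p
    apply le_antisymm
    · obtain ⟨l, hl, hl'⟩ := spectrum.exists_nnnorm_eq_spectralRadius_of_nonempty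
        (RealCFC.spectrum_nonempty hp)
      rw [ContinuousLinearMap.spectralRadius_eq_nnnorm _ hp] at hl'
      obtain ⟨x, hx, rfl⟩ := RealCFC.spectrum_aeval ha p hl (RealCFC.spectrum_nonempty ha)
      have h2 : ‖p.eval x‖ = ‖aeval a p‖ := by
        have := ENNReal.coe_inj.mp hl'
        exact congrArg NNReal.toReal this
      rw [← h2]
      exact (p.toContinuousMapOn (spectrum ℝ a)).norm_coe_le_norm ⟨x, hx⟩
    · rw [ContinuousMap.norm_le _ (norm_nonneg _)]
      rintro ⟨x, hx⟩
      exact spectrum.norm_le_norm_of_mem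
        (spectrum.subset_polynomial_aeval a p ⟨x, hx, rfl⟩)

theorem RealCFC.denseRange (s : Set ℝ) [CompactSpace s] :
    DenseRange (Polynomial.toContinuousMapOnAlgHom s : ℝ[X] → C(s, ℝ)) := by
  have h := polynomialFunctions.topologicalClosure s
  intro f
  have : f ∈ (polynomialFunctions s).topologicalClosure := h ▸ Algebra.mem_top
  simpa [← SetLike.mem_coe, Subalgebra.topologicalClosure_coe] using this

theorem RealCFC.exists_hom_aux {A : Type*} [NormedRing A] [NormedAlgebra ℝ A] [CompleteSpace A]
    [StarRing A] [ContinuousStar A] (a : A) (s : Set ℝ) [CompactSpace s]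
    (hn : ∀ p : ℝ[X], ‖aeval a p‖ = ‖p.toContinuousMapOn s‖)
    (hs : ∀ p : ℝ[X], IsSelfAdjoint (aeval a p)) :
    ∃ φ : C(s, ℝ) →⋆ₐ[ℝ] A, Isometry φ ∧
      (∀ p : ℝ[X], φ (p.toContinuousMapOn s) = aeval a p) ∧ ∀ f, IsSelfAdjoint (φ f) := by
  let e : ℝ[X] →ₐ[ℝ] C(s, ℝ) := Polynomial.toContinuousMapOnAlgHom s
  have hd : DenseRange e := RealCFC.denseRange _
  let k : ℝ[X] →ₗ[ℝ] A := (aeval a : ℝ[X] →ₐ[ℝ] A).toLinearMap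
  have hb : ∀ p : ℝ[X], ‖k p‖ ≤ 1 * ‖e.toLinearMap p‖ := by
    intro p
    rw [one_mul]
    exact (hn p).le
  let g : C(s, ℝ) →L[ℝ] A := LinearMap.extendOfNorm (Eₗ := C(s, ℝ)) k e.toLinearMap
  have hge : ∀ p, g (e p) = aeval a p := fun p =>
    LinearMap.extendOfNorm_eq (Eₗ := C(s, ℝ)) (f := k) (e := e.toLinearMap) hd ⟨1, hb⟩ p
  clear_value g
  have hgc : Continuous g := g.continuous
  have hsa : ∀ f, IsSelfAdjoint (g f) := fun f =>
    hd.induction_on f (isClosed_eq (by fun_prop) hgc) fun p => by rw [hge]; exact hs p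
  have hmul : ∀ f h, g (f * h) = g f * g h := fun f h =>
    hd.induction_on₂ (p := fun f h => g (f * h) = g f * g h)
      (isClosed_eq (by fun_prop) (by fun_prop))
      (fun p q => by rw [← map_mul, hge, hge, hge, map_mul]) f h
  have hnorm : ∀ f, ‖g f‖ = ‖f‖ := fun f =>
    hd.induction_on f (isClosed_eq (by fun_prop) (by fun_prop))
      fun p => by rw [hge]; exact hn p
  have hone : g 1 = 1 := by
    have := hge 1
    rwa [map_one e, map_one (aeval a)] at this
  let φ₀ : C(s, ℝ) →ₐ[ℝ] A := AlgHom.ofLinearMap g.toLinearMap hone hmul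
  let φ : C(s, ℝ) →⋆ₐ[ℝ] A :=
    { φ₀ with
      map_star' := fun f => by
        have h1 : star f = f := by ext x; simp
        change g (star f) = star (g f)
        rw [h1, (hsa f).star_eq] }
  exact ⟨φ, AddMonoidHomClass.isometry_of_norm φ hnorm, hge, hsa⟩

theorem RealCFC.exists_hom {a : H →L[ℝ] H} (ha : IsSelfAdjoint a) :
    ∃ φ : C(spectrum ℝ a, ℝ) →⋆ₐ[ℝ] (H →L[ℝ] H), Isometry φ ∧
      (∀ p : ℝ[X], φ (p.toContinuousMapOn (spectrum ℝ a)) = aeval a p) ∧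
      ∀ f, IsSelfAdjoint (φ f) :=
  RealCFC.exists_hom_aux a _ (RealCFC.norm_aeval ha) (RealCFC.isSelfAdjoint_aeval ha)

/-- Mathlib's continuous functional calculus `f ↦ f(a)`, for self-adjoint operators on a real
Hilbert space. -/
instance RealCFC.instContinuousFunctionalCalculus :
    ContinuousFunctionalCalculus ℝ (H →L[ℝ] H) IsSelfAdjoint where
  predicate_zero := .zero _
  spectrum_nonempty _ ha := RealCFC.spectrum_nonempty ha
  exists_cfc_of_predicate a ha := by
    obtain ⟨φ, hiso, hpoly, hsa⟩ := RealCFC.exists_hom ha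
    refine ⟨φ, hiso.continuous, hiso.injective, ?_, ?_, hsa⟩
    · have := hpoly X
      rw [aeval_X] at this
      refine Eq.trans (congrArg φ ?_) this
      ext x
      simp
    · intro f
      apply Set.Subset.antisymm
      · rw [← ContinuousMap.spectrum_eq_range f]
        exact AlgHom.spectrum_apply_subset φ f
      · rintro _ ⟨x, rfl⟩
        rw [spectrum.mem_iff]
        refine (RealCFC.denseRange (spectrum ℝ a)).induction_on
          (p := fun f => ¬ IsUnit (algebraMap ℝ (H →L[ℝ] H) (f x) - φ f)) f ?_ fun p => ?_
        · have hc : Continuous fun f : C(spectrum ℝ a, ℝ) =>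
              algebraMap ℝ (H →L[ℝ] H) (f x) - φ f :=
            ((continuous_algebraMap ℝ _).comp (continuous_eval_const x)).sub
              hiso.continuous
          exact (Units.isOpen.preimage hc).isClosed_compl
        · have := hpoly p
          simp only [toContinuousMapOnAlgHom_apply]
          rw [this]
          exact spectrum.subset_polynomial_aeval a p ⟨x, x.2, rfl⟩

end RealCFC

/-! Regularisation methods. A function on `[0, ∞)` or `(0, ∞)` is represented by a function on `ℝ`
of which only the values on that half-line are used. -/

/-- The error function `(1 - l * r_α(l)) ^ 2` of a family `r`. -/
def regError (r : ℝ → ℝ → ℝ) (α l : ℝ) : ℝ := (1 - l * r α l) ^ 2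

/-- The family `(r_α)_{α > 0}` of functions `[0, ∞) → [0, ∞)` generates a regularisation method. -/
structure IsRegGenerator (r : ℝ → ℝ → ℝ) : Prop where
  continuousOn : ∀ α, 0 < α → ContinuousOn (r α) (Set.Ici 0)
  nonneg : ∀ α, 0 < α → ∀ l, 0 ≤ l → 0 ≤ r α l
  bound : ∃ ρ : ℝ, 0 < ρ ∧ ρ < 1 ∧
    ∀ l, 0 < l → ∀ α, 0 < α → r α l ≤ min (1 / l) (ρ / √(α * l))
  error_antitoneOn : ∀ α, 0 < α → AntitoneOn (regError r α) (Set.Ici 0)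
  error_continuousOn : ∀ l, 0 ≤ l → ContinuousOn (fun α => regError r α l) (Set.Ioi 0)
  error_monotoneOn : ∀ l, 0 ≤ l → MonotoneOn (fun α => regError r α l) (Set.Ioi 0)
  error_diag : ∃ ρ' : ℝ, 0 < ρ' ∧ ρ' < 1 ∧ ∀ α, 0 < α → regError r α α < ρ'

section Hilbert

variable {X Y : Type*} [NormedAddCommGroup X] [InnerProductSpace ℝ X] [CompleteSpace X]
  [NormedAddCommGroup Y] [InnerProductSpace ℝ Y] [CompleteSpace Y]

/-- The regularised solution `x_α(y) = r_α(L* L) L* y`. -/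
noncomputable def regSolution (r : ℝ → ℝ → ℝ) (L : X →L[ℝ] Y) (α : ℝ) (y : Y) : X :=
  cfc (r α) (L.adjoint ∘L L) (L.adjoint y)

/-- `x` is the solution of `L x = y` of minimal norm. -/
def IsMinNormSolution (L : X →L[ℝ] Y) (y : Y) (x : X) : Prop :=
  L x = y ∧ ∀ z : X, L z = y → ‖x‖ ≤ ‖z‖

end Hilbert

/-- The function `α ↦ √(α φ(α))`. -/
noncomputable def rateRoot (φ : ℝ → ℝ) (α : ℝ) : ℝ := √(α * φ α)

/-- The inverse `δ ↦ inf {α ≥ 0 | δ ≤ f α}` of an increasing function `f` on `[0, ∞)`. It is the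
ordinary inverse on the range of a strictly increasing `f`, see `monoInv_apply`. -/
noncomputable def monoInv (f : ℝ → ℝ) (δ : ℝ) : ℝ := sInf {α : ℝ | 0 ≤ α ∧ δ ≤ f α}

theorem monoInv_apply {f : ℝ → ℝ} (hf : StrictMonoOn f (Set.Ici 0)) {α : ℝ} (hα : 0 ≤ α) :
    monoInv f (f α) = α := by
  have h : {β : ℝ | 0 ≤ β ∧ f α ≤ f β} = Set.Ici α := by
    ext β
    constructor
    · rintro ⟨h0, h1⟩
      exact (hf.le_iff_le hα h0).mp h1
    · intro h1
      have h0 : 0 ≤ β := hα.trans h1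
      exact ⟨h0, (hf.le_iff_le hα h0).mpr h1⟩
  rw [monoInv, h, csInf_Ici]

/-- The function `ψ(δ) = δ ^ 2 / φ̃⁻¹(δ)` with `φ̃(α) = √(α φ(α))`. -/
noncomputable def noisyRate (φ : ℝ → ℝ) (δ : ℝ) : ℝ := δ ^ 2 / monoInv (rateRoot φ) δ

/-! Put `T = L* L`. The squared error for exact data is the quadratic form of the error function of
`T` at the minimum norm solution, so pointwise inequalities on the spectrum become error estimates.

From exact to noisy data (`noisy_of_exact`): noise of size `δ` adds at most `δ / √α` to the error.
With `s = φ̃⁻¹(δ)` and `α = s / 2`, the noise and the exact error each contribute `O(δ ^ 2 / s)` to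
the squared error.

From noisy to exact data, let `α > 0` lie in the spectrum and let `d` be the exact squared error at
`α`. `exists_noise` gives noise localised near `α` whose cross term with the error is nonnegative.
Give it size `δ` with `δ ^ 2 = α d / κ`. Parameters `β ≤ α` amplify it to at least `d`, and
parameters `β ≥ α` already have exact error at least `d`. Hence `d ≤ c ψ(δ)`, which forces `φ̃⁻¹(δ)
≤ (c / κ) α`; this unwinds to `d ≤ 2 c φ(2 c α / κ)`, and `g` absorbs the dilation
(`exact_of_noisy_of_mem_spectrum`).

For `α` in a spectral gap, `exact_of_exact_on_spectrum` splits the error function at `α`. The first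
ratio condition compares the part above with the next spectral point `b ≥ α`; `exists_majorant_low`
compares the part below with the last positive spectral point `a ≤ α`. If there is no such `a`, only
the kernel of `L` is left below, and the minimum norm solution is orthogonal to it. -/

open scoped InnerProductSpace

/-! ### Quadratic forms of the functional calculus -/

section Quad

variable {H : Type*} [NormedAddCommGroup H] [InnerProductSpace ℝ H] [CompleteSpace H]

/-- The quadratic form of `f(a)` is the squared norm of `g(a) x` if `f = g ^ 2`. -/
theorem norm_sq_cfc_apply {a : H →L[ℝ] H} (ha : IsSelfAdjoint a) {f : ℝ → ℝ}
    (hf : ContinuousOn f (spectrum ℝ a)) (x : H) :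
    ‖cfc f a x‖ ^ 2 = ⟪cfc (fun l => f l ^ 2) a x, x⟫_ℝ := by
  have hs : (cfc f a).adjoint = cfc f a := (cfc_predicate f a : IsSelfAdjoint _).adjoint_eq
  rw [cfc_pow f 2 a hf ha, pow_two (cfc f a), mul_apply_eq_comp]
  conv_rhs => rw [← hs, ContinuousLinearMap.adjoint_inner_left, hs]
  rw [real_inner_self_eq_norm_sq]

theorem inner_cfc_apply_nonneg {a : H →L[ℝ] H} (ha : IsSelfAdjoint a) {f : ℝ → ℝ}
    (hf : ContinuousOn f (spectrum ℝ a)) (h0 : ∀ l ∈ spectrum ℝ a, 0 ≤ f l) (x : H) :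
    0 ≤ ⟪cfc f a x, x⟫_ℝ := by
  have h := norm_sq_cfc_apply ha (f := fun l => √(f l)) hf.sqrt x
  rw [cfc_congr (f := fun l => √(f l) ^ 2) (g := f) fun l hl => Real.sq_sqrt (h0 l hl)] at h
  rw [← h]
  positivity

theorem inner_cfc_apply_mono {a : H →L[ℝ] H} (ha : IsSelfAdjoint a) {f g : ℝ → ℝ}
    (hf : ContinuousOn f (spectrum ℝ a)) (hg : ContinuousOn g (spectrum ℝ a))
    (h : ∀ l ∈ spectrum ℝ a, f l ≤ g l) (x : H) :
    ⟪cfc f a x, x⟫_ℝ ≤ ⟪cfc g a x, x⟫_ℝ := by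
  have := inner_cfc_apply_nonneg ha (hg.sub hf) (fun l hl => sub_nonneg.mpr (h l hl)) x
  rw [show (g - f) = fun l => g l - f l from rfl, cfc_sub g f a hg hf,
    sub_apply, inner_sub_left] at this
  linarith

theorem cfc_mul_apply {a : H →L[ℝ] H} {f g : ℝ → ℝ}
    (hf : ContinuousOn f (spectrum ℝ a)) (hg : ContinuousOn g (spectrum ℝ a)) (x : H) :
    cfc (fun l => f l * g l) a x = cfc f a (cfc g a x) := by
  rw [cfc_mul f g a hf hg, mul_apply_eq_comp]

theorem inner_cfc_apply_comm {a : H →L[ℝ] H} (f : ℝ → ℝ) (x y : H) :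
    ⟪cfc f a x, y⟫_ℝ = ⟪x, cfc f a y⟫_ℝ := by
  have hs : (cfc f a).adjoint = cfc f a := (cfc_predicate f a : IsSelfAdjoint _).adjoint_eq
  conv_lhs => rw [← hs, ContinuousLinearMap.adjoint_inner_left]

end Quad

/-! ### The functional calculus of `L* L` and minimum norm solutions -/

section Gram

variable {X Y : Type*} [NormedAddCommGroup X] [InnerProductSpace ℝ X] [CompleteSpace X]
  [NormedAddCommGroup Y] [InnerProductSpace ℝ Y] [CompleteSpace Y] (L : X →L[ℝ] Y)

theorem isSelfAdjoint_gram : IsSelfAdjoint (L.adjoint ∘L L) :=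
  (ContinuousLinearMap.isPositive_adjoint_comp_self L).isSelfAdjoint

theorem spectrum_gram_nonneg {l : ℝ} (hl : l ∈ spectrum ℝ (L.adjoint ∘L L)) : 0 ≤ l :=
  SpectrumRestricts.nnreal_iff.mp
    (ContinuousLinearMap.isPositive_adjoint_comp_self L).spectrumRestricts _ hl

theorem spectrum_gram_subset : spectrum ℝ (L.adjoint ∘L L) ⊆ Set.Ici 0 :=
  fun _ => spectrum_gram_nonneg L

theorem cfc_gram_adjoint_apply {f : ℝ → ℝ} (hf : ContinuousOn f (Set.Ici 0)) (x : X) :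
    cfc f (L.adjoint ∘L L) (L.adjoint (L x)) = cfc (fun l => l * f l) (L.adjoint ∘L L) x := by
  have hf := hf.mono (spectrum_gram_subset L)
  rw [cfc_congr (g := fun l => f l * l) fun l _ => mul_comm _ _,
    cfc_mul_apply (g := fun l => l) hf continuousOn_id, cfc_id' ℝ _ (isSelfAdjoint_gram L)]
  rfl

theorem adjoint_apply_cfc_gram {f : ℝ → ℝ} (hf : ContinuousOn f (Set.Ici 0)) (x : X) :
    L.adjoint (L (cfc f (L.adjoint ∘L L) x)) = cfc (fun l => l * f l) (L.adjoint ∘L L) x := by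
  have hf := hf.mono (spectrum_gram_subset L)
  rw [cfc_mul_apply (f := fun l => l) continuousOn_id hf, cfc_id' ℝ _ (isSelfAdjoint_gram L)]
  rfl

theorem norm_sq_apply_cfc_gram {f : ℝ → ℝ} (hf : ContinuousOn f (Set.Ici 0)) (x : X) :
    ‖L (cfc f (L.adjoint ∘L L) x)‖ ^ 2 =
      ⟪cfc (fun l => l * f l ^ 2) (L.adjoint ∘L L) x, x⟫_ℝ := by
  rw [← real_inner_self_eq_norm_sq, ← ContinuousLinearMap.adjoint_inner_left,
    adjoint_apply_cfc_gram L hf, ← inner_cfc_apply_comm, ← cfc_mul_apply]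
  · congr 3
    ext l
    ring
  · exact hf.mono (spectrum_gram_subset L)
  · exact continuousOn_id.mul (hf.mono (spectrum_gram_subset L))

/-- A bound on `l * f l ^ 2` bounds the norm of `f(L* L) L*`. -/
theorem norm_cfc_gram_adjoint_le {f : ℝ → ℝ} (hf : ContinuousOn f (Set.Ici 0)) {M : ℝ}
    (hM : 0 ≤ M) (h : ∀ l, 0 ≤ l → l * f l ^ 2 ≤ M ^ 2) (z : Y) :
    ‖cfc f (L.adjoint ∘L L) (L.adjoint z)‖ ≤ M * ‖z‖ := by
  -- The adjoint `L f(L* L)` has the same norm, and its squared norm at `x` is a quadratic form of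
  -- `L* L`.
  have hle : ‖L ∘L cfc f (L.adjoint ∘L L)‖ ≤ M := by
    refine ContinuousLinearMap.opNorm_le_bound _ hM fun x => ?_
    refine abs_le_of_sq_le_sq' ?_ (by positivity) |>.2
    have hc : ContinuousOn (fun l => l * f l ^ 2) (spectrum ℝ (L.adjoint ∘L L)) :=
      continuousOn_id.mul ((hf.mono (spectrum_gram_subset L)).pow 2)
    rw [ContinuousLinearMap.comp_apply, norm_sq_apply_cfc_gram L hf]
    refine (inner_cfc_apply_mono (isSelfAdjoint_gram L) hc
      (continuousOn_const (c := M ^ 2))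
      (fun l hl => h l (spectrum_gram_nonneg L hl)) x).trans_eq ?_
    rw [cfc_const _ _ (isSelfAdjoint_gram L), Algebra.algebraMap_eq_smul_one,
      smul_apply, one_apply_eq_self, inner_smul_left,
      real_inner_self_eq_norm_sq]
    simp [mul_pow]
  have hadj : (L ∘L cfc f (L.adjoint ∘L L)).adjoint = cfc f (L.adjoint ∘L L) ∘L L.adjoint := by
    rw [ContinuousLinearMap.adjoint_comp,
      (cfc_predicate f (L.adjoint ∘L L) : IsSelfAdjoint _).adjoint_eq]
  have := (L ∘L cfc f (L.adjoint ∘L L)).adjoint.le_opNorm z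
  rw [LinearIsometryEquiv.norm_map, hadj] at this
  exact this.trans (by gcongr)

-- Subtracting from `x` its component along `k` leaves a solution, strictly shorter unless that
-- component vanishes.
omit [CompleteSpace X] [CompleteSpace Y] in
theorem IsMinNormSolution.inner_eq_zero {L : X →L[ℝ] Y} {y : Y} {x : X}
    (hx : IsMinNormSolution L y x) {k : X} (hk : L k = 0) : ⟪k, x⟫_ℝ = 0 := by
  by_contra hne
  have hk0 : k ≠ 0 := by rintro rfl; simp at hne
  have hkk : 0 < ‖k‖ ^ 2 := by positivity
  have h := hx.2 (x - (⟪k, x⟫_ℝ / ‖k‖ ^ 2) • k) (by simp [hk, hx.1])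
  have h2 := pow_le_pow_left₀ (norm_nonneg _) h 2
  rw [norm_sub_sq_real, inner_smul_right, norm_smul, mul_pow, Real.norm_eq_abs, sq_abs,
    real_inner_comm k x] at h2
  have h3 : ⟪k, x⟫_ℝ / ‖k‖ ^ 2 * ⟪k, x⟫_ℝ = ⟪k, x⟫_ℝ ^ 2 / ‖k‖ ^ 2 := by ring
  have h4 : (⟪k, x⟫_ℝ / ‖k‖ ^ 2) ^ 2 * ‖k‖ ^ 2 = ⟪k, x⟫_ℝ ^ 2 / ‖k‖ ^ 2 := by field_simp
  have h5 : 0 < ⟪k, x⟫_ℝ ^ 2 / ‖k‖ ^ 2 := by positivity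
  linarith

end Gram

/-! ### Pointwise estimates for the generating functions -/

namespace IsRegGenerator

variable {r : ℝ → ℝ → ℝ} (hr : IsRegGenerator r)
include hr

theorem mul_nonneg {α l : ℝ} (hα : 0 < α) (hl : 0 ≤ l) : 0 ≤ l * r α l :=
  _root_.mul_nonneg hl (hr.nonneg α hα l hl)

theorem mul_le_one {α l : ℝ} (hα : 0 < α) (hl : 0 ≤ l) : l * r α l ≤ 1 := by
  rcases hl.eq_or_lt with rfl | hl
  · simp
  · obtain ⟨ρ, -, -, h⟩ := hr.bound
    have := (h l hl α hα).trans (min_le_left _ _)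
    rwa [le_div_iff₀ hl, mul_comm] at this

theorem continuousOn_mul {α : ℝ} (hα : 0 < α) : ContinuousOn (fun l => l * r α l) (Set.Ici 0) :=
  continuousOn_id.mul (hr.continuousOn α hα)

theorem continuousOn_one_sub {α : ℝ} (hα : 0 < α) :
    ContinuousOn (fun l => 1 - l * r α l) (Set.Ici 0) :=
  continuousOn_const.sub (hr.continuousOn_mul hα)

theorem continuousOn_one_sub_mul {α : ℝ} (hα : 0 < α) :
    ContinuousOn (fun l => (1 - l * r α l) * (l * r α l)) (Set.Ici 0) :=
  (hr.continuousOn_one_sub hα).mul (hr.continuousOn_mul hα)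

theorem continuousOn_error {α : ℝ} (hα : 0 < α) : ContinuousOn (regError r α) (Set.Ici 0) :=
  (hr.continuousOn_one_sub hα).pow 2

theorem error_le_one {α l : ℝ} (hα : 0 < α) (hl : 0 ≤ l) : regError r α l ≤ 1 := by
  have h0 := hr.mul_nonneg hα hl
  have h1 := hr.mul_le_one hα hl
  unfold regError
  nlinarith

/-- The error functions are bounded from below on `l ≤ α`. -/
theorem exists_le_error : ∃ ε : ℝ, 0 < ε ∧ ∀ α l, 0 < α → 0 ≤ l → l ≤ α → ε ≤ regError r α l := by
  obtain ⟨ρ, hρ0, hρ1, h⟩ := hr.bound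
  refine ⟨(1 - ρ) ^ 2, pow_pos (by linarith) 2, fun α l hα hl hlα => ?_⟩
  have : l * r α l ≤ ρ := by
    rcases hl.eq_or_lt with rfl | hl
    · simpa using hρ0.le
    · have h1 := (h l hl α hα).trans (min_le_right _ _)
      have h2 : l ≤ √(α * l) := Real.le_sqrt_of_sq_le (by nlinarith)
      rw [le_div_iff₀ (hl.trans_le h2), mul_comm] at h1
      exact (mul_le_mul_of_nonneg_right h2 (hr.nonneg α hα l hl.le)).trans h1
  exact pow_le_pow_left₀ (by linarith) (by linarith) 2

/-- Squaring the bound `ρ / √(α l)` cancels `l`. This controls noise propagation. -/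
theorem mul_sq_le : ∀ α l, 0 < α → 0 ≤ l → l * r α l ^ 2 ≤ (1 / √α) ^ 2 := by
  intro α l hα hl
  rcases hl.eq_or_lt with rfl | hl
  · rw [zero_mul]; positivity
  · obtain ⟨ρ, hρ0, hρ1, h⟩ := hr.bound
    have h1 := (h l hl α hα).trans (min_le_right _ _)
    have h2 := pow_le_pow_left₀ (hr.nonneg α hα l hl.le) h1 2
    rw [div_pow, Real.sq_sqrt (by positivity)] at h2
    rw [div_pow, Real.sq_sqrt hα.le]
    calc l * r α l ^ 2 ≤ l * (ρ ^ 2 / (α * l)) := by gcongr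
      _ = ρ ^ 2 / α := by field_simp
      _ ≤ 1 ^ 2 / α := by gcongr

/-- Near the diagonal, `l * r_β(l) ^ 2` is bounded from below by a multiple of `1 / α` for all
`β ≤ α`. -/
theorem exists_le_mul_sq : ∃ κ : ℝ, 0 < κ ∧ ∀ α, 0 < α → ∃ ε, 0 < ε ∧ ∀ β l, 0 < β → β ≤ α →
    0 ≤ l → |l - α| < ε → κ / α ≤ l * r β l ^ 2 := by
  obtain ⟨ρ, hρ0, hρ1, h⟩ := hr.error_diag
  have hs1 : √ρ < 1 := by rw [Real.sqrt_lt' one_pos]; simpa using hρ1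
  refine ⟨(1 - √ρ) ^ 2 / 2, by have : 0 < 1 - √ρ := by linarith
                               positivity, fun α hα => ?_⟩
  have hc : ContinuousAt (regError r α) α :=
    (hr.continuousOn_error hα).continuousAt (Ici_mem_nhds hα)
  obtain ⟨ε, hε, hball⟩ := Metric.eventually_nhds_iff.mp (hc.eventually_lt_const (h α hα))
  -- The radius `α` keeps `0 < l < 2 α`; the upper bound is the source of the factor `1 / 2` in `κ`.
  refine ⟨min ε α, lt_min hε hα, fun β l hβ hβα hl hlα => ?_⟩
  rw [lt_min_iff, abs_lt, abs_lt] at hlα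
  have hl0 : 0 < l := by linarith [hlα.2.1]
  -- Continuity in `l` gives the bound at parameter `α`; monotonicity in the parameter carries it to
  -- every `β ≤ α`.
  have he : regError r β l < ρ :=
    (hr.error_monotoneOn l hl hβ hα hβα).trans_lt
      (hball (by rw [Real.dist_eq, abs_lt]; exact hlα.1))
  have hk : 1 - √ρ ≤ l * r β l := by
    have := Real.abs_le_sqrt he.le
    linarith [(abs_le.mp this).2]
  calc (1 - √ρ) ^ 2 / 2 / α = (1 - √ρ) ^ 2 / (2 * α) := by rw [div_div]
    _ ≤ (l * r β l) ^ 2 / l := by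
      gcongr
      linarith [hlα.2.2]
    _ = l * r β l ^ 2 := by field_simp

/-! ### Exact and noisy errors of the regularised solutions -/

variable {X Y : Type*} [NormedAddCommGroup X] [InnerProductSpace ℝ X] [CompleteSpace X]
  [NormedAddCommGroup Y] [InnerProductSpace ℝ Y] [CompleteSpace Y] (L : X →L[ℝ] Y)

theorem sub_regSolution {α : ℝ} (hα : 0 < α) (x : X) :
    x - regSolution r L α (L x) = cfc (fun l => 1 - l * r α l) (L.adjoint ∘L L) x := by
  rw [regSolution, cfc_gram_adjoint_apply L (hr.continuousOn α hα),
    cfc_sub (fun _ => 1) _ _ continuousOn_const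
      ((hr.continuousOn_mul hα).mono (spectrum_gram_subset L)),
    cfc_const_one ℝ _ (isSelfAdjoint_gram L), sub_apply,
    one_apply_eq_self]

/-- The squared error for exact data is the quadratic form of the error function. -/
theorem norm_sq_regSolution_sub {α : ℝ} (hα : 0 < α) (x : X) :
    ‖regSolution r L α (L x) - x‖ ^ 2 = ⟪cfc (regError r α) (L.adjoint ∘L L) x, x⟫_ℝ := by
  rw [norm_sub_rev, hr.sub_regSolution L hα, norm_sq_cfc_apply (isSelfAdjoint_gram L)
    ((hr.continuousOn_one_sub hα).mono (spectrum_gram_subset L))]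
  rfl

theorem norm_sq_regSolution_sub_mono {α β : ℝ} (hα : 0 < α) (h : α ≤ β) (x : X) :
    ‖regSolution r L α (L x) - x‖ ^ 2 ≤ ‖regSolution r L β (L x) - x‖ ^ 2 := by
  have hβ := hα.trans_le h
  rw [hr.norm_sq_regSolution_sub L hα, hr.norm_sq_regSolution_sub L hβ]
  exact inner_cfc_apply_mono (isSelfAdjoint_gram L)
    ((hr.continuousOn_error hα).mono (spectrum_gram_subset L))
    ((hr.continuousOn_error hβ).mono (spectrum_gram_subset L))
    (fun l hl => hr.error_monotoneOn l (spectrum_gram_nonneg L hl) hα hβ h) x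

theorem norm_sq_regSolution_sub_le {α : ℝ} (hα : 0 < α) (x : X) :
    ‖regSolution r L α (L x) - x‖ ^ 2 ≤ ‖x‖ ^ 2 := by
  rw [hr.norm_sq_regSolution_sub L hα]
  refine (inner_cfc_apply_mono (isSelfAdjoint_gram L)
    ((hr.continuousOn_error hα).mono (spectrum_gram_subset L)) (continuousOn_const (c := 1))
    (fun l hl => hr.error_le_one hα (spectrum_gram_nonneg L hl)) x).trans_eq ?_
  rw [cfc_const_one ℝ _ (isSelfAdjoint_gram L), one_apply_eq_self,
    real_inner_self_eq_norm_sq]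

theorem norm_regSolution_sub_regSolution_le {α : ℝ} (hα : 0 < α) (y z : Y) :
    ‖regSolution r L α z - regSolution r L α y‖ ≤ 1 / √α * ‖z - y‖ := by
  rw [regSolution, regSolution, ← map_sub, ← map_sub]
  exact norm_cfc_gram_adjoint_le L (hr.continuousOn α hα) (by positivity)
    (fun l hl => hr.mul_sq_le α l hα hl) _

/-- The expansion of the squared error for data perturbed by `-t L w`. -/
theorem norm_sq_regSolution_perturbed {α : ℝ} (hα : 0 < α) (x w : X) (t : ℝ) :
    ‖regSolution r L α (L x - t • L w) - x‖ ^ 2 = ‖regSolution r L α (L x) - x‖ ^ 2 +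
      2 * t * ⟪cfc (fun l => (1 - l * r α l) * (l * r α l)) (L.adjoint ∘L L) x, w⟫_ℝ +
      t ^ 2 * ‖cfc (fun l => l * r α l) (L.adjoint ∘L L) w‖ ^ 2 := by
  have h : x - regSolution r L α (L x - t • L w) = (x - regSolution r L α (L x)) +
      t • cfc (fun l => l * r α l) (L.adjoint ∘L L) w := by
    rw [← cfc_gram_adjoint_apply L (hr.continuousOn α hα)]
    simp only [regSolution, map_sub, map_smul]
    abel
  have h1 := (hr.continuousOn_mul hα).mono (spectrum_gram_subset L)
  have h2 := (hr.continuousOn_one_sub hα).mono (spectrum_gram_subset L)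
  have hi : ⟪cfc (fun l => (1 - l * r α l) * (l * r α l)) (L.adjoint ∘L L) x, w⟫_ℝ =
      ⟪x - regSolution r L α (L x), cfc (fun l => l * r α l) (L.adjoint ∘L L) w⟫_ℝ := by
    rw [hr.sub_regSolution L hα, ← inner_cfc_apply_comm, ← cfc_mul_apply h1 h2]
    simp only [mul_comm]
  rw [norm_sub_rev, h, norm_add_sq_real, norm_sub_rev, inner_smul_right, norm_smul, mul_pow,
    Real.norm_eq_abs, sq_abs, hi]
  ring

/-- At a positive point `α` of the spectrum of `L* L` there is a direction in which noise does not
decrease the error of any regularised solution, and is amplified by at least `1 / α` if the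
regularisation parameter is at most `α`. -/
theorem exists_noise : ∃ κ : ℝ, 0 < κ ∧ ∀ α ∈ spectrum ℝ (L.adjoint ∘L L), 0 < α → ∀ x : X,
    ∃ w : X, L w ≠ 0 ∧ ∀ t, 0 ≤ t → ∀ β, 0 < β →
      ‖regSolution r L β (L x) - x‖ ^ 2 ≤ ‖regSolution r L β (L x - t • L w) - x‖ ^ 2 ∧
      (β ≤ α → κ / α * (t * ‖L w‖) ^ 2 ≤ ‖regSolution r L β (L x - t • L w) - x‖ ^ 2) := by
  obtain ⟨κ, hκ, hdiag⟩ := hr.exists_le_mul_sq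
  refine ⟨κ, hκ, fun α hα hα0 x => ?_⟩
  obtain ⟨ε, hε, hd⟩ := hdiag α hα0
  -- A tent function `h` at `α` stands in for a spectral projection; the direction will be `w = h(L*
  -- L) v`.
  have hT := isSelfAdjoint_gram L
  obtain ⟨h, hcont, hnn, hone, hsupp⟩ : ∃ h : ℝ → ℝ, Continuous h ∧ (∀ l, 0 ≤ h l) ∧ h α = 1 ∧
      ∀ l, h l ≠ 0 → |l - α| < ε := by
    refine ⟨fun l => max 0 (1 - |l - α| / ε), by fun_prop, fun l => le_max_left _ _, by simp,
      fun l hl => ?_⟩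
    by_contra! hle
    exact hl (max_eq_left (by rw [sub_nonpos, le_div_iff₀ hε]; linarith))
  have hc {s : Set ℝ} : ContinuousOn h s := hcont.continuousOn
  obtain ⟨v, hLv, hin⟩ : ∃ v, L (cfc h (L.adjoint ∘L L) v) ≠ 0 ∧ ∀ β, 0 < β →
      0 ≤ ⟪cfc (fun l => (1 - l * r β l) * (l * r β l)) (L.adjoint ∘L L) x,
        cfc h (L.adjoint ∘L L) v⟫_ℝ := by
    by_cases hx : L (cfc h (L.adjoint ∘L L) x) = 0
    -- If `x` has no component usable near `α`, any direction localised there has zero cross term. A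
    -- nonzero one exists, since `l * h l ^ 2` equals `α` at the spectral point `α`.
    · obtain ⟨u, hu⟩ : ∃ u, L (cfc h (L.adjoint ∘L L) (cfc h (L.adjoint ∘L L) u)) ≠ 0 := by
        by_contra! hall
        have hz : cfc (fun l => l * (h l * h l)) (L.adjoint ∘L L) =
            cfc (fun _ => (0 : ℝ)) (L.adjoint ∘L L) := by
          ext u
          have h1 := hall u
          rw [← cfc_mul_apply hc hc] at h1
          rw [← adjoint_apply_cfc_gram L (f := fun l => h l * h l) (hc.mul hc), h1]
          simp
        have hcc : ContinuousOn (fun l => l * (h l * h l)) (spectrum ℝ (L.adjoint ∘L L)) :=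
          continuousOn_id.mul (hc.mul hc)
        have := (cfc_eq_cfc_iff_eqOn (ha := hT) (hf := hcc) (hg := continuousOn_const)).mp hz hα
        simp only [hone] at this
        linarith
      refine ⟨_, hu, fun β hβ => le_of_eq ?_⟩
      have h1 : ContinuousOn (fun l => (1 - l * r β l) * r β l) (Set.Ici 0) :=
        (hr.continuousOn_one_sub hβ).mul (hr.continuousOn β hβ)
      have h2 := (hr.continuousOn_one_sub_mul hβ).mono (spectrum_gram_subset L)
      have h3 : ContinuousOn (fun l => l * h l) (spectrum ℝ (L.adjoint ∘L L)) :=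
        continuousOn_id.mul hc
      have hTx := adjoint_apply_cfc_gram L hc x
      rw [hx, map_zero] at hTx
      rw [← inner_cfc_apply_comm, ← cfc_mul_apply hc h2,
        show (fun l => h l * ((1 - l * r β l) * (l * r β l))) =
          fun l => ((1 - l * r β l) * r β l) * (l * h l) by ext l; ring,
        cfc_mul_apply (h1.mono (spectrum_gram_subset L)) h3, ← hTx]
      simp
    -- With `v = x` the cross term is the quadratic form of a nonnegative function.
    · refine ⟨x, hx, fun β hβ => ?_⟩
      have h2 := (hr.continuousOn_one_sub_mul hβ).mono (spectrum_gram_subset L)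
      rw [← inner_cfc_apply_comm, ← cfc_mul_apply hc h2]
      refine inner_cfc_apply_nonneg hT (hc.mul h2) (fun l hl => ?_) x
      have hl := spectrum_gram_nonneg L hl
      exact _root_.mul_nonneg (hnn l) (_root_.mul_nonneg
        (sub_nonneg.mpr (hr.mul_le_one hβ hl)) (hr.mul_nonneg hβ hl))
  refine ⟨_, hLv, fun t ht β hβ => ?_⟩
  rw [hr.norm_sq_regSolution_perturbed L hβ]
  have hin := _root_.mul_nonneg (_root_.mul_nonneg zero_le_two ht) (hin β hβ)
  refine ⟨by nlinarith [sq_nonneg (t * ‖cfc (fun l => l * r β l) (L.adjoint ∘L L)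
    (cfc h (L.adjoint ∘L L) v)‖)], fun hβα => ?_⟩
  have h1 := (hr.continuousOn_mul hβ).mono (spectrum_gram_subset L)
  have hcl : ContinuousOn (fun l => l * h l ^ 2) (spectrum ℝ (L.adjoint ∘L L)) :=
    continuousOn_id.mul (hc.pow 2)
  have hm : ContinuousOn (fun l => l * r β l * h l) (spectrum ℝ (L.adjoint ∘L L)) := h1.mul hc
  have hlow : κ / α * ‖L (cfc h (L.adjoint ∘L L) v)‖ ^ 2 ≤
      ‖cfc (fun l => l * r β l) (L.adjoint ∘L L) (cfc h (L.adjoint ∘L L) v)‖ ^ 2 := by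
    rw [norm_sq_apply_cfc_gram L hc, ← cfc_mul_apply h1 hc, norm_sq_cfc_apply hT hm,
      ← real_inner_smul_left, ← smul_apply, ← cfc_const_mul _ _ _ hcl]
    refine inner_cfc_apply_mono hT (continuousOn_const.mul hcl) (hm.pow 2)
      (fun l hl => ?_) v
    have hl := spectrum_gram_nonneg L hl
    by_cases h0 : h l = 0
    · simp [h0]
    · calc κ / α * (l * h l ^ 2) ≤ (l * r β l ^ 2) * (l * h l ^ 2) := by
            gcongr
            exact hd β l hβ hβα hl (hsupp l h0)
        _ = (l * r β l * h l) ^ 2 := by ring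
  have := mul_le_mul_of_nonneg_left hlow (sq_nonneg t)
  have h0 := sq_nonneg ‖regSolution r L β (L x) - x‖
  calc _ = t ^ 2 * (κ / α * ‖L (cfc h (L.adjoint ∘L L) v)‖ ^ 2) := by ring
    _ ≤ _ := by linarith

end IsRegGenerator

/-! ### The generalised inverse of `φ̃` -/

section Rate

variable {φ : ℝ → ℝ} (hφ : StrictMonoOn φ (Set.Ici 0)) (hφ0 : φ 0 = 0)
include hφ hφ0

theorem StrictMonoOn.pos_of_map_zero {α : ℝ} (hα : 0 < α) : 0 < φ α :=
  hφ0 ▸ hφ Set.self_mem_Ici hα.le hα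

/-- Comparing `φ` with `φ 1` on either side of `1` shows that `φ̃` is unbounded and tends to `0` at
`0`, without continuity of `φ`. Thus the infimum is over a nonempty set and the quotient in
`noisyRate` is genuine. -/
theorem monoInv_rateRoot_pos {δ : ℝ} (hδ : 0 < δ) : 0 < monoInv (rateRoot φ) δ := by
  have h1 := hφ.pos_of_map_zero hφ0 one_pos
  have hne : {α : ℝ | 0 ≤ α ∧ δ ≤ rateRoot φ α}.Nonempty := by
    refine ⟨max 1 (δ ^ 2 / φ 1), by positivity, Real.le_sqrt_of_sq_le ?_⟩
    calc δ ^ 2 = δ ^ 2 / φ 1 * φ 1 := by field_simp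
      _ ≤ max 1 (δ ^ 2 / φ 1) * φ (max 1 (δ ^ 2 / φ 1)) := by
        gcongr
        · exact le_max_right _ _
        · exact hφ.monotoneOn (by simp) (by simp) (le_max_left _ _)
  refine (lt_min one_pos (by positivity : 0 < δ ^ 2 / φ 1)).trans_le (le_csInf hne ?_)
  rintro β ⟨hβ0, hβ⟩
  by_contra! hlt
  obtain ⟨hβ1, hβ2⟩ := lt_min_iff.mp hlt
  rw [lt_div_iff₀ h1] at hβ2
  have : β * φ β < δ ^ 2 := by
    refine (mul_le_mul_of_nonneg_left ?_ hβ0).trans_lt hβ2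
    exact hφ.monotoneOn hβ0 (by simp) hβ1.le
  exact hβ.not_gt ((Real.sqrt_lt' hδ).mpr this)

omit hφ hφ0 in
theorem rateRoot_lt_of_lt_monoInv {α δ : ℝ} (hα : 0 ≤ α) (h : α < monoInv (rateRoot φ) δ) :
    rateRoot φ α < δ := by
  by_contra! hle
  exact h.not_ge (csInf_le ⟨0, fun _ h => h.1⟩ ⟨hα, hle⟩)

theorem le_rateRoot_of_monoInv_lt {α δ : ℝ} (hδ : 0 < δ) (h : monoInv (rateRoot φ) δ < α) :
    δ ≤ rateRoot φ α := by
  have hne : {α : ℝ | 0 ≤ α ∧ δ ≤ rateRoot φ α}.Nonempty := by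
    by_contra! hem
    have := monoInv_rateRoot_pos hφ hφ0 hδ
    rw [monoInv, hem, Real.sInf_empty] at this
    exact this.false
  obtain ⟨β, ⟨hβ0, hβ⟩, hβα⟩ := exists_lt_of_csInf_lt hne h
  refine hβ.trans (Real.sqrt_le_sqrt ?_)
  have hφβ : 0 ≤ φ β := hφ0 ▸ hφ.monotoneOn Set.self_mem_Ici hβ0 hβ0
  exact mul_le_mul hβα.le (hφ.monotoneOn hβ0 (hβ0.trans hβα.le) hβα.le) hφβ
    (hβ0.trans hβα.le)

end Rate

/-! ### The two implications -/

section Equivalence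

variable {X Y : Type*} [NormedAddCommGroup X] [InnerProductSpace ℝ X] [CompleteSpace X]
  [NormedAddCommGroup Y] [InnerProductSpace ℝ Y] [CompleteSpace Y] {L : X →L[ℝ] Y}
  {r : ℝ → ℝ → ℝ} {φ g : ℝ → ℝ}

/-- The noisy rate from the noise-free rate. -/
theorem IsRegGenerator.noisy_of_exact (hr : IsRegGenerator r) (hφ : StrictMonoOn φ (Set.Ici 0))
    (hφ0 : φ 0 = 0) {y : Y} {x : X} {c : ℝ} (hc : 0 < c)
    (h : ∀ α, 0 < α → ‖regSolution r L α y - x‖ ^ 2 ≤ c * φ α) {δ : ℝ} (hδ : 0 < δ) :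
    (⨆ y' ∈ Metric.closedBall y δ, ⨅ α > (0 : ℝ), ‖regSolution r L α y' - x‖ₑ ^ 2)
      ≤ ENNReal.ofReal ((4 * c + 4) * noisyRate φ δ) := by
  refine iSup₂_le fun y' hy' => ?_
  have hs := monoInv_rateRoot_pos hφ hφ0 hδ
  rw [noisyRate]
  set s := monoInv (rateRoot φ) δ
  -- Strictly below `s` one has `φ̃ < δ`; at `s` itself this may fail if `φ` jumps.
  have hα : 0 < s / 2 := half_pos hs
  refine (iInf₂_le (s / 2) hα).trans ?_
  rw [← ofReal_norm, ← ENNReal.ofReal_pow (norm_nonneg _)]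
  refine ENNReal.ofReal_le_ofReal ?_
  have h1 := (Real.sqrt_lt' hδ).mp (rateRoot_lt_of_lt_monoInv hα.le (half_lt_self hs))
  have hφs : φ (s / 2) ≤ 2 * (δ ^ 2 / s) := by
    rw [← mul_div_assoc, le_div_iff₀ hs]
    linarith
  have h2 := hr.norm_regSolution_sub_regSolution_le L hα y y'
  have hy : ‖y' - y‖ ≤ δ := by simpa [dist_eq_norm] using hy'
  have h3 : ‖regSolution r L (s / 2) y' - regSolution r L (s / 2) y‖ ^ 2 ≤ 2 * (δ ^ 2 / s) := by
    refine (pow_le_pow_left₀ (norm_nonneg _) h2 2).trans ?_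
    rw [mul_pow, div_pow, Real.sq_sqrt hα.le]
    calc 1 ^ 2 / (s / 2) * ‖y' - y‖ ^ 2 ≤ 1 ^ 2 / (s / 2) * δ ^ 2 := by gcongr
      _ = _ := by field_simp
  have h4 := h (s / 2) hα
  have h5 := mul_le_mul_of_nonneg_left hφs hc.le
  have h6 := norm_add_le (regSolution r L (s / 2) y' - regSolution r L (s / 2) y)
    (regSolution r L (s / 2) y - x)
  rw [sub_add_sub_cancel] at h6
  have h7 := (pow_le_pow_left₀ (norm_nonneg _) h6 2).trans (add_sq_le)
  calc _ ≤ _ := h7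
    _ ≤ 2 * (2 * (δ ^ 2 / s) + c * (2 * (δ ^ 2 / s))) := by gcongr; exact h4.trans h5
    _ = _ := by ring

/-- The noise-free rate on the spectrum from the noisy rate. -/
theorem IsRegGenerator.exact_of_noisy_of_mem_spectrum (hr : IsRegGenerator r)
    (hφ : StrictMonoOn φ (Set.Ici 0)) (hφ0 : φ 0 = 0) (hgpos : ∀ γ, 0 < γ → 0 < g γ)
    (hφg : ∀ α, 0 < α → ∀ γ, 0 < γ → φ (γ * α) ≤ g γ * φ α) {x : X} {c : ℝ} (hc : 0 < c)
    (h : ∀ δ, 0 < δ →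
      (⨆ y' ∈ Metric.closedBall (L x) δ, ⨅ α > (0 : ℝ), ‖regSolution r L α y' - x‖ₑ ^ 2)
        ≤ ENNReal.ofReal (c * noisyRate φ δ)) :
    ∃ c' : ℝ, 0 < c' ∧ ∀ α ∈ spectrum ℝ (L.adjoint ∘L L), 0 < α →
      ‖regSolution r L α (L x) - x‖ ^ 2 ≤ c' * φ α := by
  obtain ⟨κ, hκ, hn⟩ := hr.exists_noise L
  have hγ : 0 < 2 * c / κ := by positivity
  have hg0 := hgpos _ hγ
  refine ⟨2 * c * g (2 * c / κ), by positivity, fun α hασ hα => ?_⟩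
  obtain ⟨w, hw, hlow⟩ := hn α hασ hα x
  have hφα := hφ.pos_of_map_zero hφ0 hα
  rcases (sq_nonneg ‖regSolution r L α (L x) - x‖).eq_or_lt with hd0 | hd0
  -- A vanishing error is treated apart because the noise level `√(α * d / κ)` must be positive.
  · rw [← hd0]; positivity
  set d := ‖regSolution r L α (L x) - x‖ ^ 2 with hd
  have hδ2 : 0 < α * d / κ := by positivity
  have hδ : 0 < √(α * d / κ) := Real.sqrt_pos.mpr hδ2
  have hsq := Real.sq_sqrt hδ2.le
  have hψ := h _ hδ
  rw [noisyRate, hsq] at hψ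
  have hs := monoInv_rateRoot_pos hφ hφ0 hδ
  have hroot := le_rateRoot_of_monoInv_lt (α := 2 * c / κ * α) hφ hφ0 hδ
  set δ := √(α * d / κ)
  set s := monoInv (rateRoot φ) δ
  have hw0 : 0 < ‖L w‖ := norm_pos_iff.mpr hw
  have hdle : d ≤ c * (α * d / κ / s) := by
    refine (ENNReal.ofReal_le_ofReal_iff (by positivity)).mp (le_trans ?_ hψ)
    refine le_trans ?_ (le_iSup₂ (f := fun y' (_ : y' ∈ Metric.closedBall (L x) δ) =>
      ⨅ α > (0 : ℝ), ‖regSolution r L α y' - x‖ₑ ^ 2) (L x - (δ / ‖L w‖) • L w) ?_)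
    · refine le_iInf₂ fun β hβ => ?_
      rw [← ofReal_norm, ← ENNReal.ofReal_pow (norm_nonneg _)]
      refine ENNReal.ofReal_le_ofReal ?_
      obtain ⟨h1, h2⟩ := hlow (δ / ‖L w‖) (by positivity) β hβ
      rcases le_total β α with hle | hle
      · refine le_trans (le_of_eq ?_) (h2 hle)
        rw [div_mul_cancel₀ _ hw0.ne', hsq]
        field_simp
      · exact (hr.norm_sq_regSolution_sub_mono L hα hle x).trans h1
    · rw [Metric.mem_closedBall, dist_eq_norm, sub_sub_cancel_left, norm_neg, norm_smul,
        Real.norm_of_nonneg (by positivity), div_mul_cancel₀ _ hw0.ne']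
  have hsle : s ≤ c / κ * α := by
    rw [← mul_div_assoc, le_div_iff₀ hs] at hdle
    refine le_of_mul_le_mul_left (hdle.trans_eq ?_) hd0
    ring
  -- The factor `2` makes the inequality strict: `φ̃ ≥ δ` is only available beyond the infimum `s`.
  have hlt : s < 2 * c / κ * α := by
    refine hsle.trans_lt ?_
    have : 0 < c / κ * α := by positivity
    calc c / κ * α < 2 * (c / κ * α) := by linarith
      _ = _ := by ring
  have hle := pow_le_pow_left₀ hδ.le (hroot hlt) 2
  have hpos : 0 < 2 * c / κ * α := by positivity
  have hφ' := hφ.pos_of_map_zero hφ0 hpos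
  rw [rateRoot, Real.sq_sqrt (mul_pos hpos hφ').le, hsq] at hle
  have : d ≤ 2 * c * φ (2 * c / κ * α) := by
    refine le_of_mul_le_mul_left ?_ (by positivity : 0 < α / κ)
    calc α / κ * d = α * d / κ := by ring
      _ ≤ _ := hle
      _ = _ := by ring
  refine this.trans ?_
  rw [mul_assoc _ (g _)]
  exact mul_le_mul_of_nonneg_left (hφg α hα _ hγ) (by positivity)

/-- A continuous function which on the spectrum bounds the part of the error function on `l ≤ α`
and whose quadratic form at the minimum norm solution is at most `K φ(α)`. -/
theorem IsRegGenerator.exists_majorant_low (hr : IsRegGenerator r)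
    (hφ : StrictMonoOn φ (Set.Ici 0)) (hφ0 : φ 0 = 0) {x : X} (hx : IsMinNormSolution L (L x) x)
    {c : ℝ} (hc : 0 < c) (h : ∀ α ∈ spectrum ℝ (L.adjoint ∘L L), 0 < α →
      ‖regSolution r L α (L x) - x‖ ^ 2 ≤ c * φ α) :
    ∃ K, 0 < K ∧ ∀ α, 0 < α → ∃ p : ℝ → ℝ, ContinuousOn p (Set.Ici 0) ∧ (∀ l, 0 ≤ l → 0 ≤ p l) ∧
      (∀ l ∈ spectrum ℝ (L.adjoint ∘L L), l ≤ α → 1 ≤ p l) ∧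
      ⟪cfc p (L.adjoint ∘L L) x, x⟫_ℝ ≤ K * φ α := by
  obtain ⟨ε, hε, herr⟩ := hr.exists_le_error
  refine ⟨ε⁻¹ * c, by positivity, fun α hα => ?_⟩
  have hφα := hφ.pos_of_map_zero hφ0 hα
  by_cases hem : ∃ p ∈ spectrum ℝ (L.adjoint ∘L L), 0 < p ∧ p ≤ α
  · obtain ⟨p, hp, hp0, hpα⟩ := hem
    -- Cutting at `p > 0` keeps the largest spectral point `a ≤ α` away from `0`.
    obtain ⟨a, ⟨haσ, hap, haα⟩, hmax⟩ :=
      ((spectrum.isCompact (𝕜 := ℝ) (L.adjoint ∘L L)).inter_right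
        (isClosed_Icc (a := p) (b := α))).exists_isGreatest ⟨p, hp, le_rfl, hpα⟩
    have ha0 := hp0.trans_le hap
    have hca := hr.continuousOn_error ha0
    refine ⟨fun l => ε⁻¹ * regError r a l, continuousOn_const.mul hca,
      fun l _ => _root_.mul_nonneg (by positivity) (sq_nonneg _), fun l hl hlα => ?_, ?_⟩
    · change 1 ≤ ε⁻¹ * regError r a l
      have hla : l ≤ a := by
        rcases le_total p l with hpl | hpl
        · exact hmax ⟨hl, hpl, hlα⟩
        · exact hpl.trans hap
      have := herr a l ha0 (spectrum_gram_nonneg L hl) hla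
      rwa [inv_mul_eq_div, le_div_iff₀ hε, one_mul]
    · rw [cfc_const_mul _ _ _ (hca.mono (spectrum_gram_subset L)), smul_apply,
        real_inner_smul_left, ← hr.norm_sq_regSolution_sub L ha0, mul_assoc]
      gcongr
      refine (h a haσ ha0).trans ?_
      gcongr
      exact hφ.monotoneOn ha0.le hα.le haα
  · push Not at hem
    -- On the spectrum this tent vanishes except at `0`, so it maps `x` into the kernel of `L`.
    have hc0 : Continuous fun l : ℝ => max 0 (1 - l / α) := by fun_prop
    refine ⟨fun l => max 0 (1 - l / α), hc0.continuousOn, fun l _ => le_max_left _ _,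
      fun l hl hlα => ?_, ?_⟩
    · rcases (spectrum_gram_nonneg L hl).eq_or_lt with rfl | h0
      · simp
      · exact absurd (hem l hl h0) hlα.not_gt
    · rw [hx.inner_eq_zero]
      · positivity
      · rw [← norm_eq_zero, ← pow_eq_zero_iff two_ne_zero,
          norm_sq_apply_cfc_gram L hc0.continuousOn, cfc_congr (g := fun _ => (0 : ℝ))]
        · simp
        · intro l hl
          rcases (spectrum_gram_nonneg L hl).eq_or_lt with rfl | h0
          · simp
          · have h1 : 1 ≤ l / α := by rw [le_div_iff₀ hα, one_mul]; exact (hem l hl h0).le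
            simp [max_eq_left (sub_nonpos.mpr h1)]

/-- The noise-free rate on the spectrum implies the noise-free rate. -/
theorem IsRegGenerator.exact_of_exact_on_spectrum (hr : IsRegGenerator r)
    (hφ : StrictMonoOn φ (Set.Ici 0)) (hφ0 : φ 0 = 0) {x : X} (hx : IsMinNormSolution L (L x) x)
    {C : ℝ} (hC : 0 < C) (h₁ : ∀ α β l, 0 < α → α ≤ β → β ≤ l →
      regError r α l / regError r β l ≤ C * (φ α / φ β))
    {c : ℝ} (hc : 0 < c) (h : ∀ α ∈ spectrum ℝ (L.adjoint ∘L L), 0 < α →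
      ‖regSolution r L α (L x) - x‖ ^ 2 ≤ c * φ α) :
    ∃ c' : ℝ, 0 < c' ∧ ∀ α, 0 < α → ‖regSolution r L α (L x) - x‖ ^ 2 ≤ c' * φ α := by
  have hT := isSelfAdjoint_gram L
  by_cases hpos : ∃ m ∈ spectrum ℝ (L.adjoint ∘L L), 0 < m
  · obtain ⟨m, hmσ, hm⟩ := hpos
    obtain ⟨K, hK, hlow⟩ := hr.exists_majorant_low hφ hφ0 hx hc h
    have hφm := hφ.pos_of_map_zero hφ0 hm
    refine ⟨C * c + K + ‖x‖ ^ 2 / φ m, by positivity, fun α hα => ?_⟩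
    have hφα := hφ.pos_of_map_zero hφ0 hα
    have hxm : 0 ≤ ‖x‖ ^ 2 / φ m := by positivity
    -- For `α ≥ m` the trivial bound by `‖x‖ ^ 2` suffices; for `α ≤ m` there is a spectral point `b
    -- ≥ α`.
    rcases le_total m α with hle | hle
    · calc ‖regSolution r L α (L x) - x‖ ^ 2 ≤ ‖x‖ ^ 2 := hr.norm_sq_regSolution_sub_le L hα x
        _ = ‖x‖ ^ 2 / φ m * φ m := by field_simp
        _ ≤ ‖x‖ ^ 2 / φ m * φ α := by gcongr; exact hφ.monotoneOn hm.le hα.le hle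
        _ ≤ _ := by gcongr; linarith [mul_pos hC hc]
    obtain ⟨p, hpc, hp0, hp1, hpQ⟩ := hlow α hα
    obtain ⟨b, ⟨hbσ, hbα⟩, hmin⟩ :=
      ((spectrum.isCompact (𝕜 := ℝ) (L.adjoint ∘L L)).inter_right
        (isClosed_Ici (a := α))).exists_isLeast ⟨m, hmσ, hle⟩
    have hb0 : 0 < b := hα.trans_le hbα
    have hφb := hφ.pos_of_map_zero hφ0 hb0
    have hcα := (hr.continuousOn_error hα).mono (spectrum_gram_subset L)
    have hcb := (hr.continuousOn_error hb0).mono (spectrum_gram_subset L)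
    have hcb' : ContinuousOn (fun l => C * (φ α / φ b) * regError r b l)
        (spectrum ℝ (L.adjoint ∘L L)) := continuousOn_const.mul hcb
    have hpc := hpc.mono (spectrum_gram_subset L)
    have hmono := inner_cfc_apply_mono hT hcα
      (g := fun l => C * (φ α / φ b) * regError r b l + p l)
      (hcb'.add hpc) (fun l hl => by
        have hl0 := spectrum_gram_nonneg L hl
        have hb1 : 0 ≤ regError r b l := sq_nonneg _
        rcases le_total l α with hlα | hlα
        · have : 0 ≤ C * (φ α / φ b) * regError r b l := by positivity
          linarith [hp1 l hl hlα, hr.error_le_one hα hl0]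
        · have h2 : regError r α l ≤ C * (φ α / φ b) * regError r b l := by
            -- Division by zero makes the ratio condition empty here, so monotonicity in the
            -- parameter replaces it.
            rcases hb1.eq_or_lt with h0 | h0
            · have := hr.error_monotoneOn l hl0 hα hb0 hbα
              simp only at this
              rw [← h0] at this ⊢
              simpa using this
            · have := h₁ α b l hα hbα (hmin ⟨hl, hlα⟩)
              rwa [div_le_iff₀ h0] at this
          linarith [hp0 l hl0]) x
    rw [cfc_add _ _ _ hcb' hpc, cfc_const_mul _ _ _ hcb, add_apply,
      inner_add_left, smul_apply, real_inner_smul_left,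
      ← hr.norm_sq_regSolution_sub L hα, ← hr.norm_sq_regSolution_sub L hb0] at hmono
    calc _ ≤ _ := hmono
      _ ≤ C * (φ α / φ b) * (c * φ b) + K * φ α := by gcongr; exact h b hbσ hb0
      _ = (C * c + K) * φ α := by field_simp
      _ ≤ _ := mul_le_mul_of_nonneg_right (by linarith) hφα.le
  -- The spectrum is contained in `{0}`, so `L x = 0` and the minimum norm solution is `0`.
  · push Not at hpos
    have hL : L x = 0 := by
      have := norm_sq_apply_cfc_gram L (continuousOn_const (c := (1 : ℝ))) x
      rw [cfc_const_one ℝ _ hT, one_apply_eq_self, cfc_congr (g := fun _ => (0 : ℝ))] at this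
      · simpa using this
      · intro l hl
        simp [le_antisymm (hpos l hl) (spectrum_gram_nonneg L hl)]
    have hx0 : x = 0 := inner_self_eq_zero.mp (hx.inner_eq_zero hL)
    refine ⟨1, one_pos, fun α hα => ?_⟩
    have := hφ.pos_of_map_zero hφ0 hα
    simp [hx0, regSolution, this.le]

end Equivalence

/-- The supremum and infimum are taken in `[0, ∞]`, so neither can degenerate to a default value. -/
theorem proposition3p3 {X Y : Type*}
    [NormedAddCommGroup X] [InnerProductSpace ℝ X] [CompleteSpace X]
    [NormedAddCommGroup Y] [InnerProductSpace ℝ Y] [CompleteSpace Y]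
    (L : X →L[ℝ] Y) (y : Y) (xdag : X) (hx : IsMinNormSolution L y xdag)
    (r : ℝ → ℝ → ℝ) (hr : IsRegGenerator r)
    (φ g : ℝ → ℝ) (hφ : StrictMonoOn φ (Set.Ici 0)) (hφ0 : φ 0 = 0)
    (hg : MonotoneOn g (Set.Ioi 0)) (hgpos : ∀ γ, 0 < γ → 0 < g γ)
    (hφg : ∀ α, 0 < α → ∀ γ, 0 < γ → φ (γ * α) ≤ g γ * φ α)
    (h₁ : ∃ C : ℝ, 0 < C ∧ ∀ α β l, 0 < α → α ≤ β → β ≤ l →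
      regError r α l / regError r β l ≤ C * (φ α / φ β))
    (h₂ : ∃ C : ℝ, 0 < C ∧ ∀ α β l, 0 < l → l ≤ α → α ≤ β →
      C * (φ α / φ β) ≤ regError r α l / regError r β l) :
    (∃ c : ℝ, 0 < c ∧ ∀ δ, 0 < δ →
      (⨆ y' ∈ Metric.closedBall y δ, ⨅ α > (0 : ℝ), ‖regSolution r L α y' - xdag‖ₑ ^ 2)
        ≤ ENNReal.ofReal (c * noisyRate φ δ)) ↔
    (∃ c : ℝ, 0 < c ∧ ∀ α, 0 < α → ‖regSolution r L α y - xdag‖ ^ 2 ≤ c * φ α) := by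
  obtain rfl := hx.1
  constructor
  · rintro ⟨c, hc, h⟩
    obtain ⟨C, hC, h₁⟩ := h₁
    obtain ⟨c', hc', h'⟩ := hr.exact_of_noisy_of_mem_spectrum hφ hφ0 hgpos hφg hc h
    exact hr.exact_of_exact_on_spectrum hφ hφ0 hx hC h₁ hc' h'
  · rintro ⟨c, hc, h⟩
    exact ⟨4 * c + 4, by positivity, fun δ hδ => hr.noisy_of_exact hφ hφ0 hc h hδ⟩
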